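/- For a nonnegative integer $m$ let $$P_m(a)=2^{-2m}\sum_{k=0}^{m}2^k\binom{2m-2k}{m-k}\binom{m+k}{k}(a+1)^k$$ be the $m$-th Boros–Moll polynomial, and let $d_i(m)$ denote the coefficient of $a^i$ in $P_m(a)$. Put $$U(m,i)=\frac{(m+1)^2(m+1-i)R(m,i)}{i(m+i)^2},\qquad V(m,i)=\frac{(m+1)S(m,i)}{i(m+i-1)(m+i)^2},$$ $$W(m,i)=\frac{T(m,i)}{4i(m+i-1)(m+i)^2},\qquad \Delta_2(m,i)=V(m,i)^2-4U(m,i)W(m,i),$$ where $$\begin{aligned} R(m,i)={}&2i^2m^2+4mi^3+6im^2+14mi^2+2i^4+10i^3+21mi+17i^2+2m^3+12m^2+18m+10i,\\ S(m,i)={}&4i^2(i^2-2m^2)(i+m)^3+2(8i^4-4i^3m-21i^2m^2-9im^3-4m^4)(i+m)^2\\ &+(i+m)(-54m^4-121im^3-99i^2m^2-41i^3m+7i^4)-41i^4-98i^3m\\ &-187i^2m^2-262im^3-100m^4-41i^3-51i^2m-106im^2+25i^2+45im\\ &+108m^2+30i+54m,\\ T(m,i)={}&32i^2m^2(i+m)^4+16m(4i^4+18i^3m+18i^2m^2+7im^3+2m^4)(i+m)^2\\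 &+2(i+m)(120m^5+414im^4+601i^2m^3+523i^3m^2+199i^4m+15i^5)\\ &+132i^5+850i^4m+1912i^3m^2+2652i^2m^3+2084im^4+562m^5+153i^4\\ &+417i^3m+983i^2m^2+1307im^3+300m^4-48i^3-328i^2m-248im^2\\ &-432m^3-177i^2-405im-540m^2-90i-162m. \end{aligned}$$ Then for all integers $m\ge 273$ and $i$ with $m^{2/3}\le i\le m-4$ we have $\Delta_2(m,i)>0$ (so that the square root below is that of a positive real number) and $$\frac{d_i(m+1)}{d_i(m)}>\frac{-V(m,i)+\sqrt{\Delta_2(m,i)}}{2U(m,i)}.$$ -/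

import Mathlib

namespace BorosMoll

/-- The Boros-Moll polynomial
`P_m(a) = 2^(-2m) * ∑_{k=0}^{m} 2^k * C(2m-2k, m-k) * C(m+k, k) * (a+1)^k`.
All natural-number subtractions are genuine since `k ≤ m`. -/
noncomputable def poly (m : ℕ) : Polynomial ℝ :=
  Polynomial.C (1 / (2 : ℝ) ^ (2 * m)) *
    ∑ k ∈ Finset.range (m + 1),
      Polynomial.C ((2 : ℝ) ^ k * (Nat.choose (2 * m - 2 * k) (m - k) : ℝ) *
        (Nat.choose (m + k) k : ℝ)) * (Polynomial.X + 1) ^ k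

/-- `d i m` is `d_i(m)`, the coefficient of `a^i` in `P_m(a)`. -/
noncomputable def d (i m : ℕ) : ℝ := (poly m).coeff i

/-- The polynomial `R(m,i)`. -/
def R (m i : ℝ) : ℝ :=
  2 * i ^ 2 * m ^ 2 + 4 * m * i ^ 3 + 6 * i * m ^ 2 + 14 * m * i ^ 2
    + 2 * i ^ 4 + 10 * i ^ 3 + 21 * m * i
    + 17 * i ^ 2 + 2 * m ^ 3 + 12 * m ^ 2 + 18 * m + 10 * i

/-- The polynomial `S(m,i)`. -/
def S (m i : ℝ) : ℝ :=
  4 * i ^ 2 * (i ^ 2 - 2 * m ^ 2) * (i + m) ^ 3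
    + 2 * (8 * i ^ 4 - 4 * i ^ 3 * m - 21 * i ^ 2 * m ^ 2 - 9 * i * m ^ 3 - 4 * m ^ 4)
      * (i + m) ^ 2
    + (i + m) * (-54 * m ^ 4 - 121 * i * m ^ 3 - 99 * i ^ 2 * m ^ 2 - 41 * i ^ 3 * m
      + 7 * i ^ 4)
    - 41 * i ^ 4 - 98 * i ^ 3 * m - 187 * i ^ 2 * m ^ 2 - 262 * i * m ^ 3 - 100 * m ^ 4
    - 41 * i ^ 3 - 51 * i ^ 2 * m - 106 * i * m ^ 2 + 25 * i ^ 2 + 45 * i * m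
    + 108 * m ^ 2 + 30 * i + 54 * m

/-- The polynomial `T(m,i)`. -/
def T (m i : ℝ) : ℝ :=
  32 * i ^ 2 * m ^ 2 * (i + m) ^ 4
    + 16 * m * (4 * i ^ 4 + 18 * i ^ 3 * m + 18 * i ^ 2 * m ^ 2 + 7 * i * m ^ 3 + 2 * m ^ 4)
      * (i + m) ^ 2
    + 2 * (i + m) * (120 * m ^ 5 + 414 * i * m ^ 4 + 601 * i ^ 2 * m ^ 3
      + 523 * i ^ 3 * m ^ 2 + 199 * i ^ 4 * m + 15 * i ^ 5)
    + 132 * i ^ 5 + 850 * i ^ 4 * m + 1912 * i ^ 3 * m ^ 2 + 2652 * i ^ 2 * m ^ 3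
    + 2084 * i * m ^ 4 + 562 * m ^ 5 + 153 * i ^ 4
    + 417 * i ^ 3 * m + 983 * i ^ 2 * m ^ 2 + 1307 * i * m ^ 3 + 300 * m ^ 4
    - 48 * i ^ 3 - 328 * i ^ 2 * m
    - 248 * i * m ^ 2 - 432 * m ^ 3 - 177 * i ^ 2 - 405 * i * m - 540 * m ^ 2
    - 90 * i - 162 * m

/-- `U(m,i) = (m+1)^2 (m+1-i) R(m,i) / (i (m+i)^2)`. -/
noncomputable def U (m i : ℝ) : ℝ :=
  (m + 1) ^ 2 * (m + 1 - i) * R m i / (i * (m + i) ^ 2)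

/-- `V(m,i) = (m+1) S(m,i) / (i (m+i-1) (m+i)^2)`. -/
noncomputable def V (m i : ℝ) : ℝ :=
  (m + 1) * S m i / (i * (m + i - 1) * (m + i) ^ 2)

/-- `W(m,i) = T(m,i) / (4 i (m+i-1) (m+i)^2)`. -/
noncomputable def W (m i : ℝ) : ℝ :=
  T m i / (4 * i * (m + i - 1) * (m + i) ^ 2)

/-- The discriminant `Δ₂(m,i) = V(m,i)^2 - 4 U(m,i) W(m,i)`. -/
noncomputable def Delta2 (m i : ℝ) : ℝ :=
  V m i ^ 2 - 4 * U m i * W m i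

end BorosMoll

namespace BorosMoll

/-! The claim is that r = d_i(m+1)/d_i(m) exceeds the larger root of q(x) = Ux² + Vx + W. With D =
2(m+1)(m+1-i), q is negative at t/D for t = 4m²+7m+3-i² (`quadratic_mid_neg`) and positive at s/D
for s = (2m+1)(2m+3)-(m²-i²)/i² (`quadratic_lower_pos`). Since U > 0 and t < s, the discriminant is
positive and s/D lies beyond both roots. Finally r ≥ s/D (`le_d_succ`), by induction on m from the
recurrence `d_recurrence`, which is proved by telescoping. The hypothesis m^(2/3) ≤ i enters as m² ≤
i³. -/

open Polynomial in
theorem d_eq_sum (i m : ℕ) :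
    d i m = ∑ k ∈ Finset.range (m + 1),
      (2 : ℝ) ^ k * (Nat.centralBinom (m - k) : ℝ) * (Nat.choose (m + k) k : ℝ) *
        (Nat.choose k i : ℝ) / 4 ^ m := by
  have h4 : (2 : ℝ) ^ (2 * m) = 4 ^ m := by rw [pow_mul]; norm_num
  unfold d poly
  rw [coeff_C_mul, finsetSum_coeff, Finset.mul_sum, h4]
  refine Finset.sum_congr rfl fun k _ => ?_
  rw [coeff_C_mul, coeff_X_add_one_pow, Nat.centralBinom_eq_two_mul_choose, Nat.mul_sub]
  ring

/-- The `k`-th summand of `d i m`, extended by zero to `k > m`. -/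
noncomputable def summand (i m k : ℕ) : ℝ :=
  if k ≤ m then (2 : ℝ) ^ k * (Nat.centralBinom (m - k) : ℝ) * (Nat.choose (m + k) k : ℝ) *
        (Nat.choose k i : ℝ) / 4 ^ m else 0

theorem summand_of_lt {i m k : ℕ} (h : m < k) : summand i m k = 0 := if_neg (by omega)

theorem d_eq_sum_summand (i m N : ℕ) (h : m < N) :
    d i m = ∑ k ∈ Finset.range N, summand i m k := by
  rw [d_eq_sum, ← Finset.sum_subset (Finset.range_mono (Nat.succ_le_of_lt h))]
  · refine Finset.sum_congr rfl fun k hk => ?_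
    rw [summand, if_pos (by simpa [Nat.lt_succ_iff] using hk)]
  · intro k _ hk
    exact summand_of_lt (by simpa using hk)

theorem centralBinom_succ_real (j : ℕ) :
    ((j : ℝ) + 1) * Nat.centralBinom (j + 1) = 2 * (2 * j + 1) * Nat.centralBinom j := by
  exact_mod_cast Nat.succ_mul_centralBinom_succ j

theorem choose_add_succ_left (m k : ℕ) :
    ((m : ℝ) + 1) * Nat.choose (m + 1 + k) k = (m + k + 1) * Nat.choose (m + k) k := by
  have h := Nat.choose_mul_succ_eq (m + k) k
  rw [show m + k + 1 - k = m + 1 by omega, show m + k + 1 = m + 1 + k by omega] at h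
  have h' : ((m + k).choose k : ℝ) * ((m : ℝ) + 1 + k) = (m + 1 + k).choose k * ((m : ℝ) + 1) := by
    exact_mod_cast h
  linarith

theorem choose_add_succ_right (m k : ℕ) :
    ((k : ℝ) + 1) * Nat.choose (m + (k + 1)) (k + 1) = (m + k + 1) * Nat.choose (m + k) k := by
  have h := Nat.add_one_mul_choose_eq (m + k) k
  have h' : ((m : ℝ) + k + 1) * (m + k).choose k = (m + k + 1).choose (k + 1) * ((k : ℝ) + 1) := by
    exact_mod_cast h
  rw [← add_assoc]
  linarith

theorem choose_succ_mul (k i : ℕ) :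
    ((k : ℝ) + 1 - i) * Nat.choose (k + 1) i = (k + 1) * Nat.choose k i := by
  rcases le_or_gt i (k + 1) with h | h
  · have h1 := Nat.choose_mul_succ_eq k i
    have h' : (k.choose i : ℝ) * ((k : ℝ) + 1) = (k + 1).choose i * (((k + 1 - i : ℕ) : ℝ)) := by
      exact_mod_cast h1
    rw [Nat.cast_sub h] at h'
    push_cast at h'
    linarith
  · rw [Nat.choose_eq_zero_of_lt h, Nat.choose_eq_zero_of_lt (by omega : k < i)]
    simp

theorem summand_succ_left (i m k : ℕ) (hk : k ≤ m + 1) :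
    2 * ((m : ℝ) + 1) * (m - k + 1) * summand i (m + 1) k =
      (2 * (m - k) + 1) * (m + k + 1) * summand i m k := by
  rcases Nat.lt_or_ge m k with h | h
  · have : k = m + 1 := by omega
    subst this
    rw [summand_of_lt h]
    push_cast
    ring
  · obtain ⟨j, rfl⟩ := Nat.exists_eq_add_of_le h
    rw [summand, summand, if_pos (by omega), if_pos (by omega),
      show k + j + 1 - k = j + 1 by omega, show k + j - k = j by omega]
    have h1 := centralBinom_succ_real j
    have h2 := choose_add_succ_left (k + j) k
    push_cast at h2 ⊢
    rw [pow_succ]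
    field_simp
    linear_combination (2 : ℝ) * ((k : ℝ) + j + 1) * (k.choose i) * ((k + j + 1 + k).choose k) * h1 +
      (4 : ℝ) * (2 * j + 1) * (k.choose i) * (Nat.centralBinom j) * h2

theorem summand_succ_right (i m k : ℕ) (hk : k ≤ m) :
    (2 * ((m : ℝ) - k) - 1) * (k + 1 - i) * summand i m (k + 1) =
      (m - k) * (m + k + 1) * summand i m k := by
  rcases Nat.lt_or_ge k m with h | h
  · obtain ⟨j, rfl⟩ := Nat.exists_eq_add_of_lt h
    rw [summand, summand, if_pos (by omega), if_pos (by omega),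
      show k + j + 1 - (k + 1) = j by omega, show k + j + 1 - k = j + 1 by omega]
    have h1 := centralBinom_succ_real j
    have h2 := choose_add_succ_right (k + j + 1) k
    have h3 := choose_succ_mul k i
    have hk1 : (k : ℝ) + 1 ≠ 0 := by positivity
    rw [pow_succ]
    push_cast at h2 ⊢
    rw [← mul_right_inj' hk1]
    linear_combination (2 : ℝ) ^ k / 4 ^ (k + j + 1) *
      (2 * (2 * j + 1) * (Nat.centralBinom j) * (k + 1 - i) * ((k + 1).choose i) * h2 +
      2 * (2 * j + 1) * (Nat.centralBinom j) * (2 * k + j + 2) * ((k + j + 1 + k).choose k) * h3 -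
      (k + 1) * (2 * k + j + 2) * ((k + j + 1 + k).choose k) * (k.choose i) * h1)
  · have : k = m := by omega
    subst this
    rw [summand_of_lt (Nat.lt_succ_self k)]
    ring

/-- The discrete antiderivative in the telescoping proof of `d_recurrence`. -/
noncomputable def antidiff (i m k : ℕ) : ℝ :=
  ((k : ℝ) - i) * (4 * (m + 2 - i) * (m + 2 - k) ^ 2 + 2 * (2 * m + 3) * (2 * i - 3) * (m + 2 - k) +
    (2 * m + 3) * (2 * m + 4)) / ((2 * (m - k) + 3) * (m + k + 1) * (m + k + 2)) *
    summand i (m + 2) k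

theorem two_mul_intCast_add_one_ne_zero (z : ℤ) : 2 * (z : ℝ) + 1 ≠ 0 := by
  have : 2 * z + 1 ≠ 0 := by omega
  exact_mod_cast this

theorem antidiff_succ_sub (i m k : ℕ) (hk : k ≤ m + 2) :
    ((m : ℝ) + 2 - i) * (4 * (m + 1) * (m + 2)) * summand i (m + 2) k -
      2 * (m + 1) * (8 * m ^ 2 + 24 * m + 19 - 4 * i ^ 2) * summand i (m + 1) k +
      (m + i + 1) * (4 * m + 3) * (4 * m + 5) * summand i m k =
    4 * (m + 1) * (m + 2) * (antidiff i m (k + 1) - antidiff i m k) := by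
  -- The denominators are odd integers, hence nonzero even for k > m.
  have n1 : 2 * ((m : ℝ) - k) + 1 ≠ 0 := by
    simpa using two_mul_intCast_add_one_ne_zero ((m : ℤ) - k)
  have n3 : 2 * ((m : ℝ) - k) + 3 ≠ 0 := by
    have := two_mul_intCast_add_one_ne_zero ((m : ℤ) - k + 1)
    push_cast at this
    intro h; apply this; linarith
  have p1 : (m : ℝ) + k + 1 ≠ 0 := by positivity
  have p2 : (m : ℝ) + k + 2 ≠ 0 := by positivity
  have p3 : (m : ℝ) + k + 3 ≠ 0 := by positivity
  have e1 : summand i (m + 1) k =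
      2 * (m + 2) * (m - k + 2) / ((2 * (m - k) + 3) * (m + k + 2)) * summand i (m + 2) k := by
    have := summand_succ_left i (m + 1) k hk
    push_cast at this
    field_simp
    linear_combination -this
  have e0 : summand i m k = 2 * (m + 1) * (m - k + 1) / ((2 * (m - k) + 1) * (m + k + 1)) *
      summand i (m + 1) k := by
    rcases Nat.lt_or_ge (m + 1) k with h | h
    · rw [summand_of_lt h, summand_of_lt (by omega : m < k), mul_zero]
    · have := summand_succ_left i m k h
      field_simp
      linear_combination -this
  -- The factor k+1-i may vanish, so it is not divided out; `antidiff` at k+1 carries it.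
  have e2 : ((k : ℝ) + 1 - i) * summand i (m + 2) (k + 1) =
      (m - k + 2) * (m + k + 3) / (2 * (m - k) + 3) * summand i (m + 2) k := by
    have := summand_succ_right i (m + 2) k hk
    push_cast at this
    rw [div_mul_eq_mul_div, eq_div_iff n3]
    linear_combination this
  have e3 : antidiff i m (k + 1) =
      (4 * (m + 2 - i) * (m + 1 - k) ^ 2 + 2 * (2 * m + 3) * (2 * i - 3) * (m + 1 - k) +
      (2 * m + 3) * (2 * m + 4)) * (m - k + 2) /
      ((2 * (m - k) + 1) * (m + k + 2) * (2 * (m - k) + 3)) * summand i (m + 2) k := by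
    calc _ = (4 * ((m : ℝ) + 2 - i) * (m + 1 - k) ^ 2 +
          2 * (2 * m + 3) * (2 * i - 3) * (m + 1 - k) + (2 * m + 3) * (2 * m + 4)) /
          ((2 * (m - k) + 1) * (m + k + 2) * (m + k + 3)) *
          (((k : ℝ) + 1 - i) * summand i (m + 2) (k + 1)) := by
          rw [antidiff]
          push_cast
          rw [show 2 * ((m : ℝ) - (k + 1)) + 3 = 2 * (m - k) + 1 by ring,
            show (m : ℝ) + (k + 1) + 1 = m + k + 2 by ring,
            show (m : ℝ) + (k + 1) + 2 = m + k + 3 by ring]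
          ring
      _ = _ := by
          rw [e2]
          field_simp
  rw [e0, e1, e3, antidiff]
  field_simp
  ring

theorem antidiff_zero (i m : ℕ) : antidiff i m 0 = 0 := by
  rcases Nat.eq_zero_or_pos i with rfl | h
  · simp [antidiff]
  · simp [antidiff, summand, Nat.choose_eq_zero_of_lt h]

/-- The three-term recurrence of the Boros–Moll coefficients. -/
theorem d_recurrence (i m : ℕ) :
    ((m : ℝ) + 2 - i) * (4 * (m + 1) * (m + 2)) * d i (m + 2) -
      2 * (m + 1) * (8 * m ^ 2 + 24 * m + 19 - 4 * i ^ 2) * d i (m + 1) +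
      (m + i + 1) * (4 * m + 3) * (4 * m + 5) * d i m = 0 := by
  rw [d_eq_sum_summand i (m + 2) (m + 3) (by omega), d_eq_sum_summand i (m + 1) (m + 3) (by omega),
    d_eq_sum_summand i m (m + 3) (by omega), Finset.mul_sum, Finset.mul_sum, Finset.mul_sum,
    ← Finset.sum_sub_distrib, ← Finset.sum_add_distrib]
  rw [Finset.sum_congr rfl fun k hk => antidiff_succ_sub i m k
    (by have := Finset.mem_range.mp hk; omega)]
  rw [← Finset.mul_sum, Finset.sum_range_sub, antidiff_zero, antidiff,
    summand_of_lt (by omega : m + 2 < m + 3)]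
  ring

/-! ### Positivity and a lower bound for the ratio -/

theorem d_pos {i m : ℕ} (h : i ≤ m) : 0 < d i m := by
  rw [d_eq_sum]
  refine Finset.sum_pos' (fun k _ => by positivity) ⟨m, by simp, ?_⟩
  have h1 : 0 < Nat.choose (m + m) m := Nat.choose_pos (by omega)
  have h2 : 0 < Nat.choose m i := Nat.choose_pos h
  have h3 := Nat.centralBinom_pos (m - m)
  positivity

theorem d_of_lt {i m : ℕ} (h : m < i) : d i m = 0 := by
  rw [d_eq_sum]
  refine Finset.sum_eq_zero fun k hk => ?_
  have := Finset.mem_range.mp hk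
  rw [Nat.choose_eq_zero_of_lt (by omega : k < i)]
  simp

theorem d_succ_self {i : ℕ} (hi : 1 ≤ i) :
    2 * ((i : ℝ) + 1) * d i (i + 1) = (2 * i + 1) * (2 * i + 3) * d i i := by
  obtain ⟨n, rfl⟩ := Nat.exists_eq_add_of_le' hi
  -- At m = i-1 the last term of the recurrence vanishes.
  have h := d_recurrence (n + 1) n
  rw [d_of_lt (Nat.lt_succ_self n)] at h
  push_cast at h ⊢
  have hn : 2 * ((n : ℝ) + 1) ≠ 0 := by positivity
  rw [← mul_right_inj' hn]
  linear_combination h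

/-- By the recurrence the next ratio is an increasing function of the current one, so a lower bound
propagates. At m = i there is equality. -/
theorem le_d_succ {i m : ℕ} (hi : 1 ≤ i) (him : i ≤ m) (hm : m ≤ i ^ 2) :
    ((i : ℝ) ^ 2 * (2 * m + 1) * (2 * m + 3) - (m ^ 2 - i ^ 2)) * d i m ≤
      i ^ 2 * (2 * (m + 1) * (m + 1 - i)) * d i (m + 1) := by
  induction m, him using Nat.le_induction with
  | base => linear_combination -(i : ℝ) ^ 2 * d_succ_self hi
  | succ m him ih =>
    have ih := ih (by omega)
    have hrec := d_recurrence i m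
    have hd := d_pos him
    have hi' : (1 : ℝ) ≤ i := by exact_mod_cast hi
    have him' : (i : ℝ) ≤ m := by exact_mod_cast him
    have hm' : (m : ℝ) + 1 ≤ i ^ 2 := by exact_mod_cast hm
    -- i² times the middle factor 8m²+24m+19-4i², minus the target coefficient at m+1, is
    -- (4i²+1)((m+1)²-i²). Right minus left here is i⁴ + i²(8m+4) - m².
    have key : (i : ℝ) ^ 4 * (4 * m + 3) * (4 * m + 5) ≤
        (4 * i ^ 2 + 1) * (i ^ 2 * (2 * m + 1) * (2 * m + 3) - (m ^ 2 - i ^ 2)) := by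
      have : (m : ℝ) ^ 2 ≤ i ^ 2 * i ^ 2 := by nlinarith
      nlinarith [mul_nonneg (sq_nonneg (i : ℝ)) (Nat.cast_nonneg (α := ℝ) m)]
    have h1 := mul_le_mul_of_nonneg_left ih (by positivity : (0 : ℝ) ≤ 4 * i ^ 2 + 1)
    have h2 := mul_le_mul_of_nonneg_right key hd.le
    have h3 : (i : ℝ) ^ 2 * ((4 * m + 3) * (4 * m + 5) * i ^ 2 * d i m) ≤
        i ^ 2 * ((4 * i ^ 2 + 1) * (2 * (m + 1) * (m + 1 - i)) * d i (m + 1)) := by linarith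
    have h4 := mul_le_mul_of_nonneg_left (le_of_mul_le_mul_left h3 (by positivity))
      (by positivity : (0 : ℝ) ≤ m + i + 1)
    have hm1 : (0 : ℝ) < 2 * (m + 1) := by positivity
    refine le_of_mul_le_mul_left ?_ hm1
    push_cast
    linear_combination h4 - (i : ℝ) ^ 2 * hrec

/-! ### Signs of the quadratic at two points -/

theorem quadratic_lower_pos {m i : ℝ} (hi : 2 ≤ i) (him : i ≤ m) :
    0 < (m + i - 1) * R m i * (i ^ 2 * (2 * m + 1) * (2 * m + 3) - (m ^ 2 - i ^ 2)) ^ 2 +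
      2 * i ^ 2 * S m i * (i ^ 2 * (2 * m + 1) * (2 * m + 3) - (m ^ 2 - i ^ 2)) +
      i ^ 4 * T m i * (m + 1 - i) := by
  obtain ⟨k, hk, rfl⟩ : ∃ k : ℝ, 0 ≤ k ∧ i = k + 2 := ⟨i - 2, by linarith, by ring⟩
  obtain ⟨j, hj, rfl⟩ : ∃ j : ℝ, 0 ≤ j ∧ m = k + 2 + j := ⟨m - (k + 2), by linarith, by ring⟩
  unfold R S T
  ring_nf
  positivity

theorem quadratic_mid_neg {m i : ℝ} (hi : 10 ≤ i) (him : i ≤ m) (hm : m ^ 2 ≤ i ^ 3) :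
    (m + i - 1) * R m i * (4 * m ^ 2 + 7 * m + 3 - i ^ 2) ^ 2 +
      2 * S m i * (4 * m ^ 2 + 7 * m + 3 - i ^ 2) + T m i * (m + 1 - i) < 0 := by
  have hi0 : 0 ≤ i := by linarith
  have hm0 : 0 ≤ m := by linarith
  have hmi : m ≤ i ^ 2 := by
    refine le_of_sq_le_sq ?_ (by positivity)
    nlinarith [pow_nonneg hi0 3]
  -- These multiples of i³-m² and i²-m absorb all negative terms: what remains has positive
  -- coefficients in i-10 and m-i.
  have h1 : 0 ≤ (4 * m ^ 3 * i ^ 3 + 8 * m ^ 4 * i + 32 * m ^ 3 * i ^ 2 + 82 * m ^ 2 * i ^ 3 +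
      250 * m ^ 2 * i ^ 2 + 48 * m ^ 3 * i) * (i ^ 3 - m ^ 2) :=
    mul_nonneg (by positivity) (by linarith)
  have h2 : 0 ≤ 2 * m ^ 3 * i ^ 4 * (i ^ 2 - m) := mul_nonneg (by positivity) (by linarith)
  suffices 0 < -((m + i - 1) * R m i * (4 * m ^ 2 + 7 * m + 3 - i ^ 2) ^ 2 +
      2 * S m i * (4 * m ^ 2 + 7 * m + 3 - i ^ 2) + T m i * (m + 1 - i)) -
      (4 * m ^ 3 * i ^ 3 + 8 * m ^ 4 * i + 32 * m ^ 3 * i ^ 2 + 82 * m ^ 2 * i ^ 3 +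
      250 * m ^ 2 * i ^ 2 + 48 * m ^ 3 * i) * (i ^ 3 - m ^ 2) -
      2 * m ^ 3 * i ^ 4 * (i ^ 2 - m) by linarith
  clear h1 h2 hmi hm
  obtain ⟨k, hk, rfl⟩ : ∃ k : ℝ, 0 ≤ k ∧ i = k + 10 := ⟨i - 10, by linarith, by ring⟩
  obtain ⟨j, hj, rfl⟩ : ∃ j : ℝ, 0 ≤ j ∧ m = k + 10 + j := ⟨m - (k + 10), by linarith, by ring⟩
  unfold R S T
  ring_nf
  positivity

theorem quadratic_discrim_pos {a b c x : ℝ} (ha : 0 < a) (hx : a * x ^ 2 + b * x + c < 0) :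
    0 < b ^ 2 - 4 * a * c := by
  nlinarith [sq_nonneg (2 * a * x + b)]

theorem quadratic_root_lt {a b c x y : ℝ} (ha : 0 < a) (hx : a * x ^ 2 + b * x + c < 0)
    (hxy : x < y) (hy : 0 < a * y ^ 2 + b * y + c) :
    (-b + √(b ^ 2 - 4 * a * c)) / (2 * a) < y := by
  -- The values at y and x differ by (y-x)(a(x+y)+b); hence y is right of the vertex.
  have hd : 0 < a * (x + y) + b := by
    by_contra! h
    nlinarith [mul_nonneg (sub_nonneg.mpr hxy.le) (neg_nonneg.mpr h)]
  have hv : 0 < 2 * a * y + b := by nlinarith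
  have hs : √(b ^ 2 - 4 * a * c) < 2 * a * y + b := by
    rw [Real.sqrt_lt' hv]
    nlinarith
  rw [div_lt_iff₀ (by positivity)]
  linarith

theorem quadratic_UVW (m i y : ℝ) (hi : 1 ≤ i) (him : i ≤ m) :
    U m i * (y / (2 * (m + 1) * (m + 1 - i))) ^ 2 + V m i * (y / (2 * (m + 1) * (m + 1 - i))) +
      W m i = ((m + i - 1) * R m i * y ^ 2 + 2 * S m i * y + T m i * (m + 1 - i)) /
        (4 * i * (m + i - 1) * (m + i) ^ 2 * (m + 1 - i)) := by
  have h1 : i ≠ 0 := by linarith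
  have h2 : m + i - 1 ≠ 0 := by linarith
  have h3 : m + i ≠ 0 := by linarith
  have h4 : m + 1 - i ≠ 0 := by linarith
  have h5 : m + 1 ≠ 0 := by linarith
  unfold U V W
  field_simp
  ring

theorem R_pos {m i : ℝ} (hi : 0 < i) (hm : 0 < m) : 0 < R m i := by
  unfold R
  positivity

theorem ratio_bound_of_sq_le_cube {m i : ℕ} (hi : 10 ≤ i) (him : i ≤ m) (hm : m ^ 2 ≤ i ^ 3) :
    0 < Delta2 m i ∧
      (-V m i + √(Delta2 m i)) / (2 * U m i) < d i (m + 1) / d i m := by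
  have hi' : (10 : ℝ) ≤ i := by exact_mod_cast hi
  have him' : (i : ℝ) ≤ m := by exact_mod_cast him
  have hm' : (m : ℝ) ^ 2 ≤ i ^ 3 := by exact_mod_cast hm
  have hmi : m ≤ i ^ 2 := by
    refine (Nat.pow_le_pow_iff_left two_ne_zero).mp (hm.trans ?_)
    rw [← pow_mul]
    exact Nat.pow_le_pow_right (by omega) (by norm_num)
  have hd := d_pos him
  have hi0 : (0 : ℝ) < i := by linarith
  have hm0 : (0 : ℝ) < m := by linarith
  have hn : (0 : ℝ) < m + 1 - i := by linarith
  have hk : (0 : ℝ) < m + i - 1 := by linarith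
  have hR := R_pos hi0 hm0
  have hU : 0 < U m i := by unfold U; positivity
  have hden : (0 : ℝ) < 4 * i * (m + i - 1) * (m + i) ^ 2 * (m + 1 - i) := by positivity
  have hden' : (0 : ℝ) < 2 * (m + 1) * (m + 1 - i) := by positivity
  set t : ℝ := 4 * m ^ 2 + 7 * m + 3 - i ^ 2 with ht
  set s : ℝ := (i ^ 2 * (2 * m + 1) * (2 * m + 3) - (m ^ 2 - i ^ 2)) / i ^ 2 with hs
  have hneg : U m i * (t / (2 * (m + 1) * (m + 1 - i))) ^ 2 +
      V m i * (t / (2 * (m + 1) * (m + 1 - i))) + W m i < 0 := by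
    rw [quadratic_UVW _ _ _ (by linarith) him']
    exact div_neg_of_neg_of_pos (quadratic_mid_neg hi' him' hm') hden
  have hpos : 0 < U m i * (s / (2 * (m + 1) * (m + 1 - i))) ^ 2 +
      V m i * (s / (2 * (m + 1) * (m + 1 - i))) + W m i := by
    rw [quadratic_UVW _ _ _ (by linarith) him']
    refine div_pos ?_ hden
    have := quadratic_lower_pos (by linarith : (2 : ℝ) ≤ i) him'
    have := div_pos this (by positivity : (0 : ℝ) < i ^ 4)
    convert this using 1
    rw [hs]
    field_simp
  have hts : t < s := by
    rw [hs, lt_div_iff₀ (by positivity), ht]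
    nlinarith [mul_pos hm0 (pow_pos hi0 2), pow_pos hi0 3, pow_pos hi0 2, pow_pos hi0 4]
  have hle := le_d_succ (by omega) him hmi
  refine ⟨quadratic_discrim_pos hU hneg, ?_⟩
  refine (quadratic_root_lt hU hneg (div_lt_div_of_pos_right hts hden') hpos).trans_le ?_
  rw [hs, div_div, div_le_div_iff₀ (by positivity) hd]
  linarith

theorem sq_le_cube_of_rpow_le {m i : ℕ} (h : (m : ℝ) ^ ((2 : ℝ) / 3) ≤ i) : m ^ 2 ≤ i ^ 3 := by
  have h3 := pow_le_pow_left₀ (by positivity) h 3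
  rw [← Real.rpow_natCast, ← Real.rpow_mul (by positivity)] at h3
  norm_num at h3
  exact_mod_cast h3

end BorosMoll

theorem theorem4p4 (m i : ℕ) (hm : 273 ≤ m)
    (hi_lower : (m : ℝ) ^ ((2 : ℝ) / 3) ≤ (i : ℝ)) (hi_upper : (i : ℝ) ≤ (m : ℝ) - 4) :
    0 < BorosMoll.Delta2 m i ∧
      BorosMoll.d i (m + 1) / BorosMoll.d i m >
        (-BorosMoll.V m i + Real.sqrt (BorosMoll.Delta2 m i)) / (2 * BorosMoll.U m i) := by
  have hsq := BorosMoll.sq_le_cube_of_rpow_le hi_lower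
  have him : i ≤ m := by
    have : (i : ℝ) ≤ m := by linarith
    exact_mod_cast this
  -- Otherwise m² ≤ i³ ≤ 729 < 273².
  have hi : 10 ≤ i := by
    by_contra! h
    have h1 : i ^ 3 ≤ 9 ^ 3 := Nat.pow_le_pow_left (by omega) 3
    have h2 : 273 ^ 2 ≤ m ^ 2 := Nat.pow_le_pow_left hm 2
    omega
  exact BorosMoll.ratio_bound_of_sq_le_cube hi him hsq
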